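/- Let $d\ge 1$ be an integer and let $s>d/2$ be real. Let $\mathbb T^d=(\mathbb R/2\pi\mathbb Z)^d$ carry the normalized Lebesgue measure $(2\pi)^{-d}dx$, and for $f\in L_2(\mathbb T^d)$ (complex-valued) put $\widehat f(k)=(2\pi)^{-d}\int_{\mathbb T^d}f(x)e^{-ik\cdot x}\,dx$, $k\in\mathbb Z^d$. Let $H^{s,2}(\mathbb T^d)$ be the space of all $f\in L_2(\mathbb T^d)$ with $$\|f\,|\,H^{s,2}(\mathbb T^d)\|=\Big(\sum_{k\in\mathbb Z^d}\Big(1+\sum_{j=1}^d|k_j|^2\Big)^{s}\,|\widehat f(k)|^2\Big)^{1/2}<\infty .$$ For a bounded linear operator $T:X\to Y$ and $n\ge 1$ let $a_n(T)=\inf\{\|T-A\| : A:X\to Y \text{ bounded linear},\ \operatorname{rank}A<n\}$ be its $n$-th approximation number. Then every $f\in H^{s,2}(\mathbb T^d)$ is essentially bounded, the identity $I_d:H^{s,2}(\mathbb T^d)\to L_\infty(\mathbb T^d)$, $I_df=f$, is a bounded linear operator, and $$a_{n+1}\big(I_d:H^{s,2}(\mathbb T^d)\to L_\infty(\mathbb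 T^d)\big)\le\sqrt{\frac{2d}{2s-d}}\,\Big(\frac{32e}{d}\Big)^{s/2}n^{1/2-s/d}\qquad\text{for all integers } n\ge 9^d e^{d/2},$$ $$a_{n}\big(I_d:H^{s,2}(\mathbb T^d)\to L_\infty(\mathbb T^d)\big)\ge\sqrt{\frac{4d}{4s-d}}\,\Big(\frac{1}{e(d+2)}\Big)^{s/2}n^{1/2-s/d}\qquad\text{for all integers } n\ge 11^d e^{d/2}.$$ -/

import Mathlib

open MeasureTheory
open scoped ENNReal ComplexConjugate

noncomputable section

namespace PeriodicSobolev

instance instFactTwoPiPos : Fact (0 < 2 * Real.pi) := ⟨Real.two_pi_pos⟩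

/-- The `d`-dimensional torus `(ℝ / 2πℤ)^d`. -/
abbrev Torus (d : ℕ) : Type := Fin d → AddCircle (2 * Real.pi)

/-- The normalized Lebesgue measure `(2π)^{-d} dx` on the torus. -/
def torusMeasure (d : ℕ) : Measure (Torus d) :=
  Measure.pi fun _ : Fin d => (AddCircle.haarAddCircle : Measure (AddCircle (2 * Real.pi)))

instance instIsProbabilityMeasureTorusMeasure (d : ℕ) :
    IsProbabilityMeasure (torusMeasure d) := by
  unfold torusMeasure; infer_instance

/-- The exponential `x ↦ e^{i k x} = ∏ j, e^{i k_j x_j}`. -/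
def torusExp {d : ℕ} (k : Fin d → ℤ) : C(Torus d, ℂ) where
  toFun x := ∏ j : Fin d, fourier (k j) (x j)
  continuous_toFun := by fun_prop

/-- In the coordinate `x ∈ ℝ^d`, `torusExp k` is the function `e^{i k x}`. -/
theorem torusExp_coe {d : ℕ} (k : Fin d → ℤ) (x : Fin d → ℝ) :
    torusExp k (fun j => (x j : AddCircle (2 * Real.pi))) =
      Complex.exp (Complex.I * ∑ j, (k j : ℂ) * (x j : ℂ)) := by
  simp only [torusExp, ContinuousMap.coe_mk, fourier_coe_apply, Finset.mul_sum, Complex.exp_sum]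
  refine Finset.prod_congr rfl fun j _ => ?_
  congr 1
  have : (Real.pi : ℂ) ≠ 0 := by exact_mod_cast Real.pi_ne_zero
  push_cast
  field_simp

/-- The Fourier coefficient `(2π)^{-d} ∫ f(x) e^{-i k x} dx`. -/
def fourierCoeffTorus {d : ℕ} (f : Torus d → ℂ) (k : Fin d → ℤ) : ℂ :=
  ∫ x, f x * torusExp (-k) x ∂(torusMeasure d)

theorem torusExp_neg {d : ℕ} (k : Fin d → ℤ) (x : Torus d) :
    torusExp (-k) x = conj (torusExp k x) := by
  simp only [torusExp, Pi.neg_apply, fourier_neg, ContinuousMap.coe_mk, map_prod]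

theorem torusExp_add {d : ℕ} (k l : Fin d → ℤ) (x : Torus d) :
    torusExp (k + l) x = torusExp k x * torusExp l x := by
  simp only [torusExp, Pi.add_apply, fourier_add, ContinuousMap.coe_mk, ← Finset.prod_mul_distrib]

theorem torusExp_zero {d : ℕ} (x : Torus d) : torusExp (0 : Fin d → ℤ) x = 1 := by
  simp [torusExp]

theorem span_torusExp_closure_eq_top (d : ℕ) :
    (Submodule.span ℂ (Set.range (torusExp (d := d)))).topologicalClosure = ⊤ := by
  let S : StarSubalgebra ℂ C(Torus d, ℂ) :=
    { toSubalgebra := Algebra.adjoin ℂ (Set.range torusExp)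
      star_mem' := by
        change Algebra.adjoin ℂ (Set.range torusExp) ≤
          star (Algebra.adjoin ℂ (Set.range torusExp))
        refine Algebra.adjoin_le ?_
        rintro _ ⟨n, rfl⟩
        refine Algebra.subset_adjoin ⟨-n, ?_⟩
        ext1 x
        simp only [torusExp_neg, starRingEnd_apply, ContinuousMap.star_apply] }
  have hS : S.toSubalgebra.toSubmodule = Submodule.span ℂ (Set.range torusExp) := by
    apply Algebra.adjoin_eq_span_of_subset
    refine .trans (fun x => Submonoid.closure_induction (fun _ => id) ⟨0, ?_⟩ ?_)
      Submodule.subset_span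
    · ext z
      simp [torusExp_zero]
    · rintro _ _ _ _ ⟨m, rfl⟩ ⟨n, rfl⟩
      refine ⟨m + n, ?_⟩
      ext z
      simp [torusExp_add]
  have hsep : S.SeparatesPoints := by
    intro x y hxy
    rw [Ne, funext_iff, not_forall] at hxy
    obtain ⟨i, hi⟩ := hxy
    refine ⟨_, ⟨torusExp (Pi.single i 1), Algebra.subset_adjoin ⟨Pi.single i 1, rfl⟩, rfl⟩, ?_⟩
    have key : ∀ z : Torus d, torusExp (Pi.single i 1) z = fourier 1 (z i) := by
      intro z
      simp only [torusExp, ContinuousMap.coe_mk]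
      rw [Finset.prod_eq_single i]
      · simp
      · intro j _ hj
        simp [Pi.single_eq_of_ne hj]
      · simp
    change torusExp (Pi.single i 1) x ≠ torusExp (Pi.single i 1) y
    rw [key, key, fourier_one, fourier_one]
    contrapose hi
    exact AddCircle.injective_toCircle Real.two_pi_pos.ne' (Circle.ext hi)
  have htop := ContinuousMap.starSubalgebra_topologicalClosure_eq_top_of_separatesPoints S hsep
  rw [← hS]
  exact congr_arg (Subalgebra.toSubmodule <| StarSubalgebra.toSubalgebra ·) htop

/-- The exponential `e^{i k x}` as an element of `L₂`. -/
def torusExpL2 {d : ℕ} (k : Fin d → ℤ) : Lp ℂ 2 (torusMeasure d) :=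
  ContinuousMap.toLp (E := ℂ) 2 (torusMeasure d) ℂ (torusExp k)

theorem orthonormal_torusExpL2 (d : ℕ) : Orthonormal ℂ (torusExpL2 (d := d)) := by
  rw [orthonormal_iff_ite]
  intro m n
  simp only [torusExpL2, ContinuousMap.inner_toLp, ← torusExp_neg, ← torusExp_add]
  split_ifs with h
  · simp [h, torusExp_zero]
  simp only [torusExp, ContinuousMap.coe_mk, torusMeasure]
  rw [MeasureTheory.integral_fintype_prod_eq_prod]
  obtain ⟨i, hi⟩ := Function.ne_iff.mp h
  apply Finset.prod_eq_zero (Finset.mem_univ i)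
  simpa only [eq_false_intro hi, if_false, ContinuousMap.inner_toLp, ← fourier_neg,
    ← fourier_add] using! (orthonormal_iff_ite.mp <| orthonormal_fourier) (m i) (n i)

/-- The exponentials form a Hilbert basis of `L₂` of the torus. -/
def torusBasis (d : ℕ) : HilbertBasis (Fin d → ℤ) ℂ (Lp ℂ 2 (torusMeasure d)) :=
  HilbertBasis.mk (orthonormal_torusExpL2 d) (by
    have : (Submodule.span ℂ (Set.range (torusExpL2 (d := d)))).topologicalClosure = ⊤ := by
      simpa only [Submodule.map_span, ContinuousLinearMap.coe_coe, ← Set.range_comp,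
        Function.comp_def] using!
        (ContinuousMap.toLp_denseRange ℂ (torusMeasure d) ℂ
          (p := 2) (by simp)).topologicalClosure_map_submodule (span_torusExp_closure_eq_top d)
    exact this.ge)

/-- The coordinates in this basis are the Fourier coefficients. -/
theorem torusBasis_repr {d : ℕ} (f : Lp ℂ 2 (torusMeasure d)) (k : Fin d → ℤ) :
    (torusBasis d).repr f k = fourierCoeffTorus f k := by
  rw [(torusBasis d).repr_apply_apply f k, MeasureTheory.L2.inner_def, torusBasis,
    HilbertBasis.coe_mk, fourierCoeffTorus]
  apply integral_congr_ae
  filter_upwards [ContinuousMap.coeFn_toLp (𝕜 := ℂ) (p := 2) (torusMeasure d) (torusExp k)]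
    with x hx
  rw [torusExpL2, hx, torusExp_neg, RCLike.inner_apply]

/-- `f ↦ \hat f` is additive on `L₂`. -/
theorem fourierCoeffTorus_add {d : ℕ} (f g : Lp ℂ 2 (torusMeasure d)) (k : Fin d → ℤ) :
    fourierCoeffTorus (f + g : Lp ℂ 2 (torusMeasure d)) k =
      fourierCoeffTorus f k + fourierCoeffTorus g k := by
  rw [← torusBasis_repr, ← torusBasis_repr, ← torusBasis_repr, map_add]
  rfl

theorem fourierCoeffTorus_smul {d : ℕ} (c : ℂ) (f : Lp ℂ 2 (torusMeasure d))
    (k : Fin d → ℤ) :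
    fourierCoeffTorus (c • f : Lp ℂ 2 (torusMeasure d)) k = c * fourierCoeffTorus f k := by
  rw [← torusBasis_repr, ← torusBasis_repr, map_smul]
  rfl

theorem fourierCoeffTorus_zero {d : ℕ} (k : Fin d → ℤ) :
    fourierCoeffTorus (0 : Lp ℂ 2 (torusMeasure d)) k = 0 := by
  rw [← torusBasis_repr, map_zero]
  rfl

theorem eq_zero_of_fourierCoeffTorus {d : ℕ} (f : Lp ℂ 2 (torusMeasure d))
    (h : ∀ k, fourierCoeffTorus f k = 0) : f = 0 := by
  apply (torusBasis d).repr.injective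
  ext k
  simp [torusBasis_repr, h]

/-- The squared weight `(1 + ∑ j, |k_j|^2)^s` of the space `H^{s,2}`. -/
def weightSq {d : ℕ} (s : ℝ) (k : Fin d → ℤ) : ℝ :=
  (1 + ∑ j, |(k j : ℝ)| ^ 2) ^ s

theorem weightSq_pos {d : ℕ} (s : ℝ) (k : Fin d → ℤ) : 0 < weightSq s k := by
  unfold weightSq; positivity

/-- Finiteness of the `H^{s,2}` norm. -/
def HasFiniteSobolevNorm {d : ℕ} (s : ℝ) (f : Lp ℂ 2 (torusMeasure d)) : Prop :=
  Summable fun k : Fin d → ℤ => weightSq s k * ‖fourierCoeffTorus f k‖ ^ 2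

/-- The isotropic Sobolev space `H^{s,2}` as a linear subspace of `L₂`. -/
def sobolevSubmodule (d : ℕ) (s : ℝ) : Submodule ℂ (Lp ℂ 2 (torusMeasure d)) where
  carrier := {f | HasFiniteSobolevNorm s f}
  zero_mem' := by
    change HasFiniteSobolevNorm s 0
    simp only [HasFiniteSobolevNorm, fourierCoeffTorus_zero]
    simp
  add_mem' := by
    intro f g hf hg
    refine Summable.of_nonneg_of_le
      (fun k => mul_nonneg (weightSq_pos s k).le (sq_nonneg _)) (fun k => ?_)
      ((hf.mul_left 2).add (hg.mul_left 2))
    rw [fourierCoeffTorus_add]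
    have h1 := norm_add_le (fourierCoeffTorus f k) (fourierCoeffTorus g k)
    have h2 : ‖fourierCoeffTorus f k + fourierCoeffTorus g k‖ ^ 2 ≤
        2 * ‖fourierCoeffTorus f k‖ ^ 2 + 2 * ‖fourierCoeffTorus g k‖ ^ 2 := by
      nlinarith [sq_nonneg (‖fourierCoeffTorus f k‖ - ‖fourierCoeffTorus g k‖),
        norm_nonneg (fourierCoeffTorus f k + fourierCoeffTorus g k)]
    nlinarith [mul_le_mul_of_nonneg_left h2 (weightSq_pos s k).le]
  smul_mem' := by
    intro c f hf
    refine (Summable.mul_left (‖c‖ ^ 2) hf).congr fun k => ?_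
    rw [fourierCoeffTorus_smul, norm_mul]
    ring

/-- The Sobolev space `H^{s,2}` on the `d`-dimensional torus: all `f ∈ L₂` for which
`∑ k, (1 + ∑ j, |k_j|^2)^s * |\hat f (k)|^2` is finite. It is a type of its own because it
carries its own norm and not that of `L₂`. -/
def SobolevSpace (d : ℕ) (s : ℝ) : Type := sobolevSubmodule d s

namespace SobolevSpace

variable {d : ℕ} {s : ℝ}

instance instAddCommGroup : AddCommGroup (SobolevSpace d s) :=
  inferInstanceAs (AddCommGroup (sobolevSubmodule d s))

instance instModule : Module ℂ (SobolevSpace d s) :=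
  inferInstanceAs (Module ℂ (sobolevSubmodule d s))

/-- The inclusion of `H^{s,2}` in `L₂`. -/
def toL2 : SobolevSpace d s →ₗ[ℂ] Lp ℂ 2 (torusMeasure d) := (sobolevSubmodule d s).subtype

/-- The norm `(∑ k, (1 + ∑ j, |k_j|^2)^s * |\hat f (k)|^2)^{1/2}` of `H^{s,2}`. -/
instance instNorm : Norm (SobolevSpace d s) where
  norm f := Real.sqrt (∑' k : Fin d → ℤ, weightSq s k * ‖fourierCoeffTorus (toL2 f) k‖ ^ 2)

theorem norm_def (f : SobolevSpace d s) :
    ‖f‖ = Real.sqrt (∑' k : Fin d → ℤ, weightSq s k * ‖fourierCoeffTorus (toL2 f) k‖ ^ 2) := rfl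

theorem toL2_injective : Function.Injective (toL2 : SobolevSpace d s → _) :=
  Subtype.val_injective

theorem hasFiniteSobolevNorm (f : SobolevSpace d s) : HasFiniteSobolevNorm s (toL2 f) := f.2

/-- The sequence of weighted Fourier coefficients. -/
def coeffSeq (f : SobolevSpace d s) : lp (fun _ : Fin d → ℤ => ℂ) 2 :=
  ⟨fun k => (Real.sqrt (weightSq s k) : ℂ) * fourierCoeffTorus (toL2 f) k, by
    refine memℓp_gen ?_
    refine (hasFiniteSobolevNorm f).congr fun k => ?_
    simp [mul_pow, Real.sq_sqrt (weightSq_pos s k).le]⟩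

theorem norm_eq_norm_coeffSeq (f : SobolevSpace d s) : ‖f‖ = ‖coeffSeq f‖ := by
  rw [norm_def, lp.norm_eq_tsum_rpow (by simp), Real.sqrt_eq_rpow]
  simp [coeffSeq, mul_pow, Real.sq_sqrt (weightSq_pos s _).le]

theorem coeffSeq_add (f g : SobolevSpace d s) : coeffSeq (f + g) = coeffSeq f + coeffSeq g := by
  ext k
  change (Real.sqrt (weightSq s k) : ℂ) * fourierCoeffTorus (toL2 (f + g)) k =
    (Real.sqrt (weightSq s k) : ℂ) * fourierCoeffTorus (toL2 f) k +
      (Real.sqrt (weightSq s k) : ℂ) * fourierCoeffTorus (toL2 g) k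
  rw [map_add, fourierCoeffTorus_add, mul_add]

theorem coeffSeq_smul (c : ℂ) (f : SobolevSpace d s) : coeffSeq (c • f) = c • coeffSeq f := by
  ext k
  simp [coeffSeq, fourierCoeffTorus_smul, mul_left_comm]

theorem eq_zero_of_coeffSeq (f : SobolevSpace d s) (h : coeffSeq f = 0) : f = 0 := by
  apply toL2_injective
  rw [map_zero]
  apply eq_zero_of_fourierCoeffTorus
  intro k
  have hk : (Real.sqrt (weightSq s k) : ℂ) * fourierCoeffTorus (toL2 f) k = 0 :=
    congrArg (fun a : lp (fun _ : Fin d → ℤ => ℂ) 2 => a k) h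
  refine (mul_eq_zero.mp hk).resolve_left ?_
  exact_mod_cast (Real.sqrt_pos.mpr (weightSq_pos s k)).ne'

theorem normedSpaceCore : NormedSpace.Core ℂ (SobolevSpace d s) where
  norm_nonneg f := Real.sqrt_nonneg _
  norm_smul c f := by rw [norm_eq_norm_coeffSeq, norm_eq_norm_coeffSeq, coeffSeq_smul, norm_smul]
  norm_triangle f g := by
    simp only [norm_eq_norm_coeffSeq, coeffSeq_add]
    exact norm_add_le _ _
  norm_eq_zero_iff f := by
    refine ⟨fun h => eq_zero_of_coeffSeq f ?_, ?_⟩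
    · rwa [norm_eq_norm_coeffSeq, norm_eq_zero] at h
    · rintro rfl
      simp only [norm_def, map_zero, fourierCoeffTorus_zero]
      simp

instance instNormedAddCommGroup : NormedAddCommGroup (SobolevSpace d s) :=
  NormedAddCommGroup.ofCore normedSpaceCore

instance instNormedSpace : NormedSpace ℂ (SobolevSpace d s) :=
  NormedSpace.ofCore normedSpaceCore

end SobolevSpace

/-- The `n`-th approximation number of a bounded linear operator, `n ≥ 1`:
the infimum of `‖T - A‖` over all bounded linear operators `A` of rank less than `n`. -/
def approxNumber {X Y : Type*} [NormedAddCommGroup X] [NormedSpace ℂ X]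
    [NormedAddCommGroup Y] [NormedSpace ℂ Y] (T : X →L[ℂ] Y) (n : ℕ) : ℝ :=
  sInf {r : ℝ | ∃ A : X →L[ℂ] Y, (A : X →ₗ[ℂ] Y).rank < (n : Cardinal) ∧ r = ‖T - A‖}

end PeriodicSobolev

end

open MeasureTheory
open scoped ENNReal ComplexConjugate

noncomputable section

namespace PeriodicSobolev

/-! Upper bound: keep the frequencies with `1 + |k|^2 ≤ ρ`. By Cauchy–Schwarz the remaining Fourier
series converges uniformly, and its norm is at most the square root of the sum of `(1 + |k|^2)^(-s)`
over `1 + |k|^2 > ρ`. A Gaussian (theta function) majorant shows that at most `(16 e u / d)^(d/2)`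
frequencies satisfy `1 + |k|^2 ≤ u`, for every `u ≥ d/2`. This count controls both the rank of the
truncation and, through a layer-cake integral, the tail sum.

Lower bound: let `B = I - A` with `rank A < n`, and let `e k` be the weighted exponentials, an
orthonormal system of the Sobolev space. Since point values of `B f` are bounded by `‖B‖ ‖f‖`,
duality in the coefficients gives `∑ |B (e k)|^2 ≤ ‖B‖^2` almost everywhere (`ae_sum_norm_sq_le`).
Integration turns this into a Hilbert–Schmidt bound in `L₂`. There the range `V` of `A` has
dimension at most `n`, so it absorbs at most `n` of the total squared length of the exponentials
(`sum_norm_sq_starProjection_le`). On a set `F` of frequencies with weights at most `R` this leaves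
`(|F| - n) / R ≤ ‖B‖^2`; a cube with at least `4 n` points gives the stated constant. -/

/-! ### Counting lattice points and tails of the weights -/

/-- A discrete layer-cake estimate: polynomial growth of the counting function of `w` bounds
the sum of the powers `w ^ (-s)`. -/
theorem sum_rpow_neg_le_of_card_le {ι : Type*} (F : Finset ι) (w : ι → ℝ) {ρ a b s : ℝ}
    (hρ : 0 < ρ) (hs : 0 < s) (hbs : b < s) (hw : ∀ k ∈ F, ρ < w k)
    (hcard : ∀ u, ρ ≤ u → ((F.filter fun k => w k < u).card : ℝ) ≤ a * u ^ b) :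
    ∑ k ∈ F, w k ^ (-s) ≤ s / (s - b) * a * ρ ^ (b - s) := by
  classical
  have hint : ∀ c : ℝ, 0 < c → IntegrableOn (fun u : ℝ => u ^ (-s - 1)) (Set.Ioi c) := fun c hc =>
    integrableOn_Ioi_rpow_of_lt (by linarith) hc
  -- Writing each power as an integral over `(w k, ∞)` turns the sum into the integral of the
  -- counting function against `s u^(-s-1)`.
  have hval : ∀ c : ℝ, 0 < c → c ^ (-s) = s * ∫ u in Set.Ioi c, u ^ (-s - 1) := by
    intro c hc
    rw [integral_Ioi_rpow_of_lt (by linarith) hc]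
    rw [show -s - 1 + 1 = -s by ring]
    field_simp
  have hind : ∀ k ∈ F, (∫ u in Set.Ioi (w k), u ^ (-s - 1)) =
      ∫ u in Set.Ioi ρ, (Set.Ioi (w k)).indicator (fun u => u ^ (-s - 1)) u := by
    intro k hk
    rw [setIntegral_indicator measurableSet_Ioi,
      Set.inter_eq_self_of_subset_right (Set.Ioi_subset_Ioi (hw k hk).le)]
  have hindint : ∀ k ∈ F,
      IntegrableOn ((Set.Ioi (w k)).indicator (fun u : ℝ => u ^ (-s - 1))) (Set.Ioi ρ) :=
    fun k _ => (hint ρ hρ).indicator measurableSet_Ioi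
  have hb : IntegrableOn (fun u : ℝ => a * u ^ (b - s - 1)) (Set.Ioi ρ) :=
    (integrableOn_Ioi_rpow_of_lt (by linarith) hρ).const_mul a
  calc ∑ k ∈ F, w k ^ (-s)
      = s * ∫ u in Set.Ioi ρ,
          ∑ k ∈ F, (Set.Ioi (w k)).indicator (fun u : ℝ => u ^ (-s - 1)) u := by
        rw [integral_finsetSum F hindint, Finset.mul_sum]
        refine Finset.sum_congr rfl fun k hk => ?_
        rw [← hind k hk, hval _ (hρ.trans (hw k hk))]
    _ ≤ s * ∫ u in Set.Ioi ρ, a * u ^ (b - s - 1) := by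
        refine mul_le_mul_of_nonneg_left ?_ hs.le
        refine setIntegral_mono_on (integrable_finsetSum F hindint) hb measurableSet_Ioi ?_
        intro u hu
        have hu0 : 0 < u := hρ.trans hu
        have : ∑ k ∈ F, (Set.Ioi (w k)).indicator (fun u : ℝ => u ^ (-s - 1)) u =
            ((F.filter fun k => w k < u).card : ℝ) * u ^ (-s - 1) := by
          simp only [Set.indicator_apply, Set.mem_Ioi]
          rw [← Finset.sum_filter, Finset.sum_const, nsmul_eq_mul]
        rw [this]
        calc _ ≤ a * u ^ b * u ^ (-s - 1) :=
              mul_le_mul_of_nonneg_right (hcard u (le_of_lt hu)) (Real.rpow_nonneg hu0.le _)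
          _ = _ := by rw [mul_assoc, ← Real.rpow_add hu0]; ring_nf
    _ = _ := by
        rw [integral_const_mul, integral_Ioi_rpow_of_lt (by linarith) hρ,
          show b - s - 1 + 1 = b - s by ring]
        have : s - b ≠ 0 := by linarith
        have : b - s ≠ 0 := by linarith
        field_simp
        ring

/-- The term `m = 0` gives `1`; the others pair up by symmetry, and each half is a lower Riemann sum
of the decreasing Gaussian on the half-line. -/
theorem sum_Icc_exp_neg_mul_sq_le {t : ℝ} (ht : 0 < t) (M : ℕ) :
    ∑ m ∈ Finset.Icc (-(M : ℤ)) M, Real.exp (-t * (m : ℝ) ^ 2) ≤ 1 + Real.sqrt (Real.pi / t) := by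
  have hsplit : ∀ M : ℕ, ∑ m ∈ Finset.Icc (-(M : ℤ)) M, Real.exp (-t * (m : ℝ) ^ 2) =
      1 + 2 * ∑ i ∈ Finset.range M, Real.exp (-t * ((0 : ℝ) + (i + 1 : ℕ)) ^ 2) := by
    intro M
    induction M with
    | zero => simp
    | succ M ih =>
      have h : Finset.Icc (-((M + 1 : ℕ) : ℤ)) ((M + 1 : ℕ) : ℤ) =
          insert (-((M + 1 : ℕ) : ℤ)) (insert ((M + 1 : ℕ) : ℤ)
            (Finset.Icc (-(M : ℤ)) M)) := by
        ext x
        simp only [Finset.mem_Icc, Finset.mem_insert]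
        push_cast
        omega
      rw [h, Finset.sum_insert, Finset.sum_insert, ih, Finset.sum_range_succ]
      · push_cast
        ring_nf
      · simp
      · simp only [Finset.mem_Icc, Finset.mem_insert]
        push_cast
        omega
  rw [hsplit]
  have hanti : AntitoneOn (fun x : ℝ => Real.exp (-t * x ^ 2)) (Set.Icc 0 (0 + (M : ℝ))) := by
    intro x hx y _ hxy
    refine Real.exp_le_exp.mpr ?_
    have : x ^ 2 ≤ y ^ 2 := pow_le_pow_left₀ hx.1 hxy 2
    nlinarith
  have h1 := hanti.sum_le_integral
  have h2 : ∫ x in (0 : ℝ)..(0 + (M : ℝ)), Real.exp (-t * x ^ 2) ≤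
      Real.sqrt (Real.pi / t) / 2 := by
    rw [← integral_gaussian_Ioi t, intervalIntegral.integral_of_le (by positivity)]
    exact setIntegral_mono_set (integrable_exp_neg_mul_sq ht).integrableOn
      (Filter.Eventually.of_forall fun x => (Real.exp_pos _).le)
      (Set.Ioc_subset_Ioi_self).eventuallyLE
  linarith

/-- The squared Japanese bracket `1 + |k|^2`. -/
def bracketSq {d : ℕ} (k : Fin d → ℤ) : ℝ := 1 + ∑ j, |(k j : ℝ)| ^ 2

theorem one_le_bracketSq {d : ℕ} (k : Fin d → ℤ) : 1 ≤ bracketSq k := by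
  have : 0 ≤ ∑ j, |(k j : ℝ)| ^ 2 := by positivity
  unfold bracketSq
  linarith

theorem weightSq_eq {d : ℕ} (s : ℝ) (k : Fin d → ℤ) : weightSq s k = bracketSq k ^ s := rfl

theorem mem_piFinset_of_bracketSq_le {d : ℕ} {k : Fin d → ℤ} {u : ℝ} (h : bracketSq k ≤ u) :
    k ∈ Fintype.piFinset fun _ : Fin d => Finset.Icc (-(⌈u⌉₊ : ℤ)) ⌈u⌉₊ := by
  rw [Fintype.mem_piFinset]
  intro j
  rw [Finset.mem_Icc, ← abs_le]
  have h1 : |(k j : ℝ)| ^ 2 ≤ ∑ j, |(k j : ℝ)| ^ 2 :=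
    Finset.single_le_sum (f := fun j => |(k j : ℝ)| ^ 2) (fun _ _ => by positivity)
      (Finset.mem_univ j)
  have h2 : |(k j : ℝ)| ≤ u := by
    unfold bracketSq at h
    nlinarith [sq_nonneg (|(k j : ℝ)| - 1)]
  have h3 : ((|k j| : ℤ) : ℝ) ≤ ((⌈u⌉₊ : ℤ) : ℝ) := by
    push_cast
    exact h2.trans (Nat.le_ceil u)
  exact_mod_cast h3

theorem finite_bracketSq_le (d : ℕ) (u : ℝ) : {k : Fin d → ℤ | bracketSq k ≤ u}.Finite :=
  (Finset.finite_toSet _).subset fun _ hk => mem_piFinset_of_bracketSq_le hk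

/-- Each counted `k` has `exp (t (u - |k|^2)) ≥ 1`, and the sum of these majorants over a box
factors into a `d`-th power of a one-dimensional theta sum. -/
theorem card_le_of_bracketSq_le {d : ℕ} (hd : 1 ≤ d) {u : ℝ} (hu : (d : ℝ) / 2 ≤ u)
    (F : Finset (Fin d → ℤ)) (hF : ∀ k ∈ F, bracketSq k ≤ u) :
    (F.card : ℝ) ≤ (16 * Real.exp 1 / d) ^ ((d : ℝ) / 2) * u ^ ((d : ℝ) / 2) := by
  have hd0 : (0 : ℝ) < d := by exact_mod_cast hd
  have hu0 : 0 < u := by linarith [half_pos hd0]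
  -- This is the minimiser of `exp (t u) t^(-d/2)`; the assumption `u ≥ d/2` makes it at most `1`.
  set t : ℝ := d / (2 * u) with ht
  have ht0 : 0 < t := by positivity
  have ht1 : t ≤ 1 := by
    rw [ht, div_le_one (by positivity)]
    linarith
  set θ := ∑ m ∈ Finset.Icc (-(⌈u⌉₊ : ℤ)) ⌈u⌉₊, Real.exp (-t * (m : ℝ) ^ 2) with hθ
  have hθ0 : 0 ≤ θ := Finset.sum_nonneg fun _ _ => (Real.exp_pos _).le
  have hcount : (F.card : ℝ) ≤ Real.exp (t * u) * θ ^ d := by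
    have h1 : θ ^ d = ∑ k ∈ Fintype.piFinset fun _ : Fin d => Finset.Icc (-(⌈u⌉₊ : ℤ)) ⌈u⌉₊,
        ∏ j, Real.exp (-t * (k j : ℝ) ^ 2) := by
      rw [Finset.sum_prod_piFinset (Finset.Icc (-(⌈u⌉₊ : ℤ)) ⌈u⌉₊)
        (fun _ m => Real.exp (-t * (m : ℝ) ^ 2))]
      simp [hθ]
    rw [h1, Finset.mul_sum]
    calc (F.card : ℝ) = ∑ k ∈ F, (1 : ℝ) := by simp
      _ ≤ ∑ k ∈ F, Real.exp (t * u) * ∏ j, Real.exp (-t * (k j : ℝ) ^ 2) := by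
        refine Finset.sum_le_sum fun k hk => ?_
        rw [← Real.exp_sum, ← Real.exp_add, ← Finset.mul_sum]
        refine Real.one_le_exp ?_
        have := hF k hk
        simp only [bracketSq, sq_abs] at this
        nlinarith
      _ ≤ _ := by
        refine Finset.sum_le_sum_of_subset_of_nonneg
          (fun k hk => mem_piFinset_of_bracketSq_le (hF k hk)) fun _ _ _ => by positivity
  -- Since `t ≤ 1` and `q^2 ≤ 3.15 / t`, the inequality `(q - 1.8)^2 ≥ 0` yields `(1 + q)^2 ≤ 7.7 /
  -- t`.
  have hθle : θ ≤ Real.sqrt (8 / t) := by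
    refine (sum_Icc_exp_neg_mul_sq_le ht0 _).trans ?_
    refine Real.le_sqrt_of_sq_le ?_
    set q := Real.sqrt (Real.pi / t) with hq
    have hq2 : q ^ 2 = Real.pi / t := Real.sq_sqrt (by positivity)
    have hit : 1 ≤ 1 / t := by rw [le_div_iff₀ ht0]; linarith
    have h3 : q ^ 2 ≤ 3.15 * (1 / t) := by
      rw [hq2, div_eq_mul_one_div]
      nlinarith [Real.pi_lt_d2]
    rw [div_eq_mul_one_div 8 t]
    nlinarith [sq_nonneg (q - 1.8)]
  have htu : t * u = (d : ℝ) / 2 := by rw [ht]; field_simp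
  calc (F.card : ℝ) ≤ Real.exp (t * u) * θ ^ d := hcount
    _ ≤ Real.exp (t * u) * Real.sqrt (8 / t) ^ d := by gcongr
    _ = (16 * Real.exp 1 / d) ^ ((d : ℝ) / 2) * u ^ ((d : ℝ) / 2) := by
      rw [htu, ← Real.mul_rpow (by positivity) hu0.le, Real.sqrt_eq_rpow, ← Real.rpow_natCast,
        ← Real.rpow_mul (by positivity), show (1 : ℝ) / 2 * d = d / 2 by ring,
        show 16 * Real.exp 1 / d * u = Real.exp 1 * (8 / t) by rw [ht]; field_simp; ring,
        Real.mul_rpow (by positivity) (by positivity), ← Real.exp_mul, one_mul]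

theorem sum_inv_weightSq_le {d : ℕ} (hd : 1 ≤ d) {s ρ : ℝ} (hs : (d : ℝ) / 2 < s)
    (hρ : (d : ℝ) / 2 ≤ ρ) (F : Finset (Fin d → ℤ)) (hF : ∀ k ∈ F, ρ < bracketSq k) :
    ∑ k ∈ F, (weightSq s k)⁻¹ ≤
      s / (s - d / 2) * (16 * Real.exp 1 / d) ^ ((d : ℝ) / 2) * ρ ^ ((d : ℝ) / 2 - s) := by
  have hd0 : (0 : ℝ) < d := by exact_mod_cast hd
  have h := sum_rpow_neg_le_of_card_le F bracketSq (a := (16 * Real.exp 1 / d) ^ ((d : ℝ) / 2))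
    (b := (d : ℝ) / 2) (s := s) (by linarith [half_pos hd0] : 0 < ρ)
    (by linarith [half_pos hd0]) hs hF (fun u hu =>
      card_le_of_bracketSq_le hd (hρ.trans hu) _ fun k hk => (Finset.mem_filter.mp hk).2.le)
  refine le_trans (le_of_eq (Finset.sum_congr rfl fun k _ => ?_)) h
  rw [weightSq_eq, Real.rpow_neg (zero_le_one.trans (one_le_bracketSq k))]

/-- Only finitely many `k` have `1 + |k|^2 ≤ d/2`, and the tail bound with `ρ = d/2` covers the
others. -/
theorem summable_inv_weightSq {d : ℕ} (hd : 1 ≤ d) {s : ℝ} (hs : (d : ℝ) / 2 < s) :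
    Summable fun k : Fin d → ℤ => (weightSq s k)⁻¹ := by
  rw [← (finite_bracketSq_le d (d / 2)).toFinset.summable_compl_iff]
  refine summable_of_sum_le (c := s / (s - d / 2) * (16 * Real.exp 1 / d) ^ ((d : ℝ) / 2) *
    ((d : ℝ) / 2) ^ ((d : ℝ) / 2 - s)) (fun k => inv_nonneg.mpr (weightSq_pos s k.1).le) fun F => ?_
  have h := sum_inv_weightSq_le hd hs le_rfl (F.map (Function.Embedding.subtype _)) (by
    intro k hk
    obtain ⟨x, -, rfl⟩ := Finset.mem_map.mp hk
    simpa using x.2)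
  rw [Finset.sum_map] at h
  exact h

/-! ### Uniformly convergent Fourier series on the Sobolev space -/

variable {d : ℕ} {s : ℝ}

theorem norm_torusExp_le (k : Fin d → ℤ) : ‖torusExp k‖ ≤ 1 := by
  refine (ContinuousMap.norm_le _ zero_le_one).mpr fun x => ?_
  rw [torusExp, ContinuousMap.coe_mk, norm_prod]
  exact (Finset.prod_eq_one fun j _ => Circle.norm_coe _).le

namespace SobolevSpace

/-- The `k`-th Fourier coefficient as a linear functional on the Sobolev space. -/
def coeff (k : Fin d → ℤ) : SobolevSpace d s →ₗ[ℂ] ℂ where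
  toFun f := fourierCoeffTorus (toL2 f) k
  map_add' f g := by rw [map_add, fourierCoeffTorus_add]
  map_smul' c f := by rw [map_smul, fourierCoeffTorus_smul, RingHom.id_apply, smul_eq_mul]

theorem norm_sq_eq (f : SobolevSpace d s) :
    ‖f‖ ^ 2 = ∑' k, weightSq s k * ‖coeff k f‖ ^ 2 := by
  rw [norm_def, Real.sq_sqrt (tsum_nonneg fun k => by have := weightSq_pos s k; positivity)]
  rfl

/-- Cauchy--Schwarz for the Fourier coefficients over a finite set of frequencies. -/
theorem sum_norm_coeff_le (f : SobolevSpace d s) (F : Finset (Fin d → ℤ)) :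
    ∑ k ∈ F, ‖coeff k f‖ ≤ Real.sqrt (∑ k ∈ F, (weightSq s k)⁻¹) * ‖f‖ := by
  have h := Real.sum_mul_le_sqrt_mul_sqrt F (fun k => Real.sqrt ((weightSq s k)⁻¹))
    (fun k => Real.sqrt (weightSq s k) * ‖coeff k f‖)
  have h1 : ∀ k : Fin d → ℤ,
      Real.sqrt ((weightSq s k)⁻¹) * (Real.sqrt (weightSq s k) * ‖coeff k f‖) = ‖coeff k f‖ := by
    intro k
    have := Real.sqrt_pos.mpr (weightSq_pos s k)
    rw [Real.sqrt_inv]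
    field_simp
  simp only [h1, mul_pow, Real.sq_sqrt (weightSq_pos s _).le,
    Real.sq_sqrt (inv_nonneg.mpr (weightSq_pos s _).le)] at h
  refine h.trans (mul_le_mul_of_nonneg_left ?_ (Real.sqrt_nonneg _))
  rw [norm_def]
  exact Real.sqrt_le_sqrt ((hasFiniteSobolevNorm f).sum_le_tsum F
    fun k _ => by have := weightSq_pos s k; positivity)

/-- The part of the Fourier series of `f` with frequencies in `S`. -/
def partialSeries (S : Set (Fin d → ℤ)) (f : SobolevSpace d s) (k : Fin d → ℤ) : C(Torus d, ℂ) :=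
  S.indicator (fun k => coeff k f • torusExp k) k

theorem sum_norm_partialSeries_le {S : Set (Fin d → ℤ)}
    {C : ℝ} (hC : ∀ F : Finset (Fin d → ℤ), (∀ k ∈ F, k ∈ S) → ∑ k ∈ F, (weightSq s k)⁻¹ ≤ C)
    (f : SobolevSpace d s) (F : Finset (Fin d → ℤ)) :
    ∑ k ∈ F, ‖partialSeries S f k‖ ≤ Real.sqrt C * ‖f‖ := by
  classical
  calc ∑ k ∈ F, ‖partialSeries S f k‖ ≤ ∑ k ∈ F, if k ∈ S then ‖coeff k f‖ else 0 := by
        refine Finset.sum_le_sum fun k _ => ?_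
        unfold partialSeries
        rw [Set.indicator_apply]
        split_ifs
        · rw [norm_smul]
          exact mul_le_of_le_one_right (norm_nonneg _) (norm_torusExp_le k)
        · simp
    _ = ∑ k ∈ F.filter (· ∈ S), ‖coeff k f‖ := (Finset.sum_filter _ _).symm
    _ ≤ Real.sqrt (∑ k ∈ F.filter (· ∈ S), (weightSq s k)⁻¹) * ‖f‖ := sum_norm_coeff_le f _
    _ ≤ _ := by
      gcongr
      exact hC _ fun k hk => (Finset.mem_filter.mp hk).2

theorem summable_partialSeries {S : Set (Fin d → ℤ)} {C : ℝ}
    (hC : ∀ F : Finset (Fin d → ℤ), (∀ k ∈ F, k ∈ S) → ∑ k ∈ F, (weightSq s k)⁻¹ ≤ C)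
    (f : SobolevSpace d s) : Summable (partialSeries S f) :=
  .of_norm (summable_of_sum_le (fun _ => norm_nonneg _) (sum_norm_partialSeries_le hC f))

/-- The Fourier projection onto the frequencies in `S`, as an operator into the continuous
functions. -/
def fourierProj (S : Set (Fin d → ℤ)) (C : ℝ)
    (hC : ∀ F : Finset (Fin d → ℤ), (∀ k ∈ F, k ∈ S) → ∑ k ∈ F, (weightSq s k)⁻¹ ≤ C) :
    SobolevSpace d s →L[ℂ] C(Torus d, ℂ) :=
  LinearMap.mkContinuous
    { toFun := fun f => ∑' k, partialSeries S f k
      map_add' := fun f g => by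
        rw [← (summable_partialSeries hC f).tsum_add (summable_partialSeries hC g)]
        refine tsum_congr fun k => ?_
        simp only [partialSeries, map_add, add_smul, Set.indicator_add]
      map_smul' := fun c f => by
        rw [RingHom.id_apply, ← (summable_partialSeries hC f).tsum_const_smul]
        refine tsum_congr fun k => ?_
        simp only [partialSeries, map_smul, smul_eq_mul, mul_smul, Set.indicator_const_smul_apply] }
    (Real.sqrt C) fun f => by
      have hs := summable_of_sum_le (fun _ => norm_nonneg _) (sum_norm_partialSeries_le hC f)
      exact (norm_tsum_le_tsum_norm hs).trans
        (hs.tsum_le_of_sum_le (sum_norm_partialSeries_le hC f))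

theorem fourierProj_apply {S : Set (Fin d → ℤ)} {C : ℝ}
    (hC : ∀ F : Finset (Fin d → ℤ), (∀ k ∈ F, k ∈ S) → ∑ k ∈ F, (weightSq s k)⁻¹ ≤ C)
    (f : SobolevSpace d s) : fourierProj S C hC f = ∑' k, partialSeries S f k := rfl

theorem norm_fourierProj_le {S : Set (Fin d → ℤ)} {C : ℝ}
    (hC : ∀ F : Finset (Fin d → ℤ), (∀ k ∈ F, k ∈ S) → ∑ k ∈ F, (weightSq s k)⁻¹ ≤ C) :
    ‖fourierProj S C hC‖ ≤ Real.sqrt C :=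
  LinearMap.mkContinuous_norm_le _ (Real.sqrt_nonneg _) _

theorem partialSeries_add_compl (S : Set (Fin d → ℤ)) (f : SobolevSpace d s) (k : Fin d → ℤ) :
    partialSeries S f k + partialSeries Sᶜ f k = partialSeries Set.univ f k := by
  unfold partialSeries
  rw [Set.indicator_self_add_compl_apply, Set.indicator_univ]

theorem hasSum_toL2 (f : SobolevSpace d s) :
    HasSum (fun k => coeff k f • torusExpL2 k) (toL2 f) := by
  have h := (torusBasis d).hasSum_repr (toL2 f)
  simp only [torusBasis_repr] at h
  simp only [torusBasis, HilbertBasis.coe_mk] at h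
  exact h

end SobolevSpace

/-! ### The embedding and its truncations -/

open SobolevSpace

/-- The embedding of continuous functions in `L∞`. -/
def toLinfty (d : ℕ) : C(Torus d, ℂ) →L[ℂ] Lp ℂ ∞ (torusMeasure d) :=
  ContinuousMap.toLp (E := ℂ) ∞ (torusMeasure d) ℂ

theorem norm_toLinfty_le (d : ℕ) : ‖toLinfty d‖ ≤ 1 := by
  have h := ContinuousMap.toLp_norm_le (E := ℂ) (p := ∞) (𝕜 := ℂ) (torusMeasure d)
  simpa [toLinfty] using h

theorem inv_weightSq_sum_le_tsum (hd : 1 ≤ d) (hs : (d : ℝ) / 2 < s) (S : Set (Fin d → ℤ))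
    (F : Finset (Fin d → ℤ)) (_ : ∀ k ∈ F, k ∈ S) :
    ∑ k ∈ F, (weightSq s k)⁻¹ ≤ ∑' k : Fin d → ℤ, (weightSq s k)⁻¹ :=
  (summable_inv_weightSq hd hs).sum_le_tsum F fun k _ => inv_nonneg.mpr (weightSq_pos s k).le

/-- The embedding of the Sobolev space in `L∞`. -/
def embedding (hd : 1 ≤ d) (hs : (d : ℝ) / 2 < s) :
    SobolevSpace d s →L[ℂ] Lp ℂ ∞ (torusMeasure d) :=
  (toLinfty d).comp (fourierProj Set.univ _ (inv_weightSq_sum_le_tsum hd hs _))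

theorem embedding_ae_eq (hd : 1 ≤ d) (hs : (d : ℝ) / 2 < s) (f : SobolevSpace d s) :
    ⇑(embedding hd hs f) =ᵐ[torusMeasure d] ⇑(toL2 f) := by
  set g : C(Torus d, ℂ) := fourierProj Set.univ _ (inv_weightSq_sum_le_tsum hd hs _) f with hg
  have h1 : ⇑(embedding hd hs f) =ᵐ[torusMeasure d] ⇑g :=
    ContinuousMap.coeFn_toLp (𝕜 := ℂ) (p := ∞) (torusMeasure d) g
  have h2 := ContinuousMap.coeFn_toLp (𝕜 := ℂ) (p := 2) (torusMeasure d) g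
  -- The uniformly convergent series also converges in `L₂`, where it is the Hilbert basis expansion
  -- of `f`; limits are unique.
  have h3 : ContinuousMap.toLp (E := ℂ) 2 (torusMeasure d) ℂ g = toL2 f := by
    have hsum := ((summable_partialSeries (inv_weightSq_sum_le_tsum hd hs Set.univ) f).hasSum).mapL
      (ContinuousMap.toLp (E := ℂ) 2 (torusMeasure d) ℂ)
    refine hsum.unique ?_
    convert hasSum_toL2 f using 2 with k
    rw [partialSeries, Set.indicator_univ, map_smul]
    rfl
  rw [h3] at h2
  exact h1.trans h2.symm

theorem approxNumber_le {X Y : Type*} [NormedAddCommGroup X] [NormedSpace ℂ X]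
    [NormedAddCommGroup Y] [NormedSpace ℂ Y] (T A : X →L[ℂ] Y) {n : ℕ}
    (hA : (A : X →ₗ[ℂ] Y).rank < (n : Cardinal)) : approxNumber T n ≤ ‖T - A‖ :=
  csInf_le ⟨0, by rintro _ ⟨A, -, rfl⟩; exact norm_nonneg _⟩ ⟨A, hA, rfl⟩

theorem le_approxNumber {X Y : Type*} [NormedAddCommGroup X] [NormedSpace ℂ X]
    [NormedAddCommGroup Y] [NormedSpace ℂ Y] (T : X →L[ℂ] Y) {n : ℕ} (hn : 0 < n) {r : ℝ}
    (h : ∀ A : X →L[ℂ] Y, (A : X →ₗ[ℂ] Y).rank < (n : Cardinal) → r ≤ ‖T - A‖) :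
    r ≤ approxNumber T n := by
  refine le_csInf ⟨_, 0, ?_, rfl⟩ (by rintro _ ⟨A, hA, rfl⟩; exact h A hA)
  rw [ContinuousLinearMap.toLinearMap_zero, LinearMap.rank_zero]
  exact_mod_cast hn

/-- Truncating the Fourier series to a finite set `Λ` of frequencies bounds the approximation
numbers of the embedding by the tail of the weights. -/
theorem approxNumber_embedding_le (hd : 1 ≤ d) (hs : (d : ℝ) / 2 < s) (Λ : Finset (Fin d → ℤ))
    {n : ℕ} (hn : Λ.card ≤ n) {C : ℝ}
    (hC : ∀ F : Finset (Fin d → ℤ), (∀ k ∈ F, k ∉ Λ) → ∑ k ∈ F, (weightSq s k)⁻¹ ≤ C) :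
    approxNumber (embedding hd hs) (n + 1) ≤ Real.sqrt C := by
  classical
  set A : SobolevSpace d s →L[ℂ] Lp ℂ ∞ (torusMeasure d) := (toLinfty d).comp
    (fourierProj (Λ : Set (Fin d → ℤ)) _ (inv_weightSq_sum_le_tsum hd hs _)) with hA
  have hrank : (A : SobolevSpace d s →ₗ[ℂ] Lp ℂ ∞ (torusMeasure d)).rank <
      ((n + 1 : ℕ) : Cardinal) := by
    have hle : LinearMap.range (A : SobolevSpace d s →ₗ[ℂ] Lp ℂ ∞ (torusMeasure d)) ≤
        Submodule.span ℂ (Λ.image fun k => toLinfty d (torusExp k) :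
          Set (Lp ℂ ∞ (torusMeasure d))) := by
      rintro _ ⟨f, rfl⟩
      have : A f = ∑ k ∈ Λ, coeff k f • toLinfty d (torusExp k) := by
        rw [hA, ContinuousLinearMap.comp_apply, fourierProj_apply, tsum_eq_sum (s := Λ), map_sum]
        · refine Finset.sum_congr rfl fun k hk => ?_
          rw [partialSeries, Set.indicator_of_mem (Finset.mem_coe.mpr hk), map_smul]
        · intro k hk
          rw [partialSeries, Set.indicator_of_notMem (by simpa using hk)]
      change A f ∈ _
      rw [this]
      refine Submodule.sum_mem _ fun k hk => Submodule.smul_mem _ _ (Submodule.subset_span ?_)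
      exact Finset.mem_coe.mpr (Finset.mem_image_of_mem _ hk)
    calc _ ≤ Module.rank ℂ _ := Submodule.rank_mono hle
      _ ≤ ((Λ.image fun k => toLinfty d (torusExp k)).card : Cardinal) :=
        rank_span_finset_le _
      _ < _ := by
        exact_mod_cast Nat.lt_succ_of_le (Finset.card_image_le.trans hn)
  refine (approxNumber_le _ A hrank).trans ?_
  -- The error is the Fourier projection onto the complement of `Λ`, now carrying the tail constant
  -- `C` as its bound.
  have hsub : embedding hd hs - A = (toLinfty d).comp
      (fourierProj ((Λ : Set (Fin d → ℤ))ᶜ) C fun F hF => hC F fun k hk => by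
        simpa using hF k hk) := by
    rw [hA, embedding, sub_eq_iff_eq_add, ← ContinuousLinearMap.comp_add]
    congr 1
    ext1 f
    rw [_root_.add_apply, fourierProj_apply, fourierProj_apply, fourierProj_apply,
      add_comm, ← (summable_partialSeries (inv_weightSq_sum_le_tsum hd hs _) f).tsum_add
        (summable_partialSeries (fun F hF => hC F fun k hk => by simpa using hF k hk) f)]
    exact tsum_congr fun k => (partialSeries_add_compl _ f k).symm
  rw [hsub]
  refine (ContinuousLinearMap.opNorm_comp_le _ _).trans ?_
  calc _ ≤ 1 * Real.sqrt C := mul_le_mul (norm_toLinfty_le d) (norm_fourierProj_le _)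
        (norm_nonneg _) zero_le_one
    _ = _ := one_mul _

/-! ### Lower bounds through Hilbert–Schmidt norms in `L₂` -/

theorem fourierCoeffTorus_torusExpL2 (k l : Fin d → ℤ) :
    fourierCoeffTorus (torusExpL2 k) l = if l = k then 1 else 0 := by
  rw [← torusBasis_repr, (torusBasis d).repr_apply_apply, torusBasis, HilbertBasis.coe_mk]
  exact orthonormal_iff_ite.mp (orthonormal_torusExpL2 d) l k

namespace SobolevSpace

/-- The `k`-th element `(1 + |k|^2)^{-s/2} e^{i k x}` of the orthonormal basis of the Sobolev
space. -/
def basisVec (s : ℝ) (k : Fin d → ℤ) : SobolevSpace d s :=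
  ⟨(((Real.sqrt (weightSq s k))⁻¹ : ℝ) : ℂ) • torusExpL2 k, by
    refine summable_of_ne_finset_zero (s := {k}) fun l hl => ?_
    rw [fourierCoeffTorus_smul, fourierCoeffTorus_torusExpL2, if_neg (by simpa using hl)]
    simp⟩

theorem toL2_basisVec (k : Fin d → ℤ) :
    toL2 (basisVec s k) = (((Real.sqrt (weightSq s k))⁻¹ : ℝ) : ℂ) • torusExpL2 k := rfl

theorem coeff_basisVec (k l : Fin d → ℤ) :
    coeff l (basisVec s k) = if l = k then (((Real.sqrt (weightSq s k))⁻¹ : ℝ) : ℂ) else 0 := by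
  change fourierCoeffTorus (toL2 (basisVec s k)) l = _
  rw [toL2_basisVec, fourierCoeffTorus_smul, fourierCoeffTorus_torusExpL2]
  split_ifs <;> simp

/-- Orthonormality in the form needed below, since the Sobolev space carries only a norm here and no
inner product. -/
theorem norm_sum_smul_basisVec_sq (F : Finset (Fin d → ℤ)) (c : F → ℂ) :
    ‖∑ k, c k • basisVec s (k : Fin d → ℤ)‖ ^ 2 = ∑ k, ‖c k‖ ^ 2 := by
  classical
  have hc : ∀ l, coeff l (∑ k, c k • basisVec s (k : Fin d → ℤ)) =
      if h : l ∈ F then c ⟨l, h⟩ * (((Real.sqrt (weightSq s l))⁻¹ : ℝ) : ℂ) else 0 := by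
    intro l
    simp only [map_sum, map_smul, coeff_basisVec, smul_eq_mul]
    split_ifs with h
    · rw [Finset.sum_eq_single (⟨l, h⟩ : F)]
      · simp
      · intro k _ hk
        rw [if_neg, mul_zero]
        rintro rfl
        exact hk rfl
      · simp
    · refine Finset.sum_eq_zero fun k _ => ?_
      rw [if_neg, mul_zero]
      rintro rfl
      exact h k.2
  rw [norm_sq_eq, tsum_eq_sum (s := F), ← Finset.sum_coe_sort]
  · refine Finset.sum_congr rfl fun k _ => ?_
    rw [hc, dif_pos k.2, norm_mul, mul_pow, Complex.norm_real, Real.norm_eq_abs, sq_abs, inv_pow,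
      Real.sq_sqrt (weightSq_pos s _).le]
    have := weightSq_pos s (k : Fin d → ℤ)
    field_simp
  · intro l hl
    rw [hc, dif_neg hl]
    simp

end SobolevSpace

/-- A bounded operator into `L∞` maps an orthonormal system to functions whose squares sum
to at most the squared operator norm, almost everywhere. -/
theorem ae_sum_norm_sq_le {α ι X : Type*} [MeasurableSpace α] {μ : Measure α} [Fintype ι]
    [NormedAddCommGroup X] [NormedSpace ℂ X] (B : X →L[ℂ] Lp ℂ ∞ μ) (e : ι → X)
    (he : ∀ c : ι → ℂ, ‖∑ k, c k • e k‖ ^ 2 = ∑ k, ‖c k‖ ^ 2) :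
    ∀ᵐ x ∂μ, ∑ k, ‖(B (e k) : α → ℂ) x‖ ^ 2 ≤ ‖B‖ ^ 2 := by
  classical
  have hbound : ∀ c : ι → ℂ, ∀ᵐ x ∂μ,
      ‖∑ k, c k * (B (e k) : α → ℂ) x‖ ≤ ‖B‖ * Real.sqrt (∑ k, ‖c k‖ ^ 2) := by
    intro c
    have h1 : ∀ᵐ x ∂μ, (B (∑ k, c k • e k) : α → ℂ) x = ∑ k, c k * (B (e k) : α → ℂ) x := by
      have h2 : B (∑ k, c k • e k) = ∑ k, c k • B (e k) := by simp
      rw [h2]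
      have h3 := Lp.coeFn_finsetSum (Finset.univ) (fun k => c k • B (e k))
      have h4 : ∀ᵐ x ∂μ, ∀ k, (c k • B (e k) : Lp ℂ ∞ μ) x = c k * (B (e k) : α → ℂ) x := by
        rw [ae_all_iff]
        intro k
        filter_upwards [Lp.coeFn_smul (c k) (B (e k))] with x hx
        rw [hx, Pi.smul_apply, smul_eq_mul]
      filter_upwards [h3, h4] with x hx3 hx4
      rw [hx3]
      simp [hx4]
    have h5 : ∀ᵐ x ∂μ, ‖(B (∑ k, c k • e k) : α → ℂ) x‖ ≤ ‖B (∑ k, c k • e k)‖ := by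
      filter_upwards [ae_le_eLpNormEssSup (f := (B (∑ k, c k • e k) : α → ℂ)) (μ := μ)] with x hx
      rw [Lp.norm_def, eLpNorm_exponent_top, ← toReal_enorm]
      refine ENNReal.toReal_mono ?_ hx
      rw [← eLpNorm_exponent_top]
      exact Lp.eLpNorm_ne_top _
    filter_upwards [h1, h5] with x hx1 hx5
    rw [← hx1, ← he c, Real.sqrt_sq (norm_nonneg _)]
    exact hx5.trans (B.le_opNorm _)
  -- The exceptional null set in `hbound` depends on `c`. A countable dense family of coefficients
  -- gives one null set for all, and continuity in `c` extends the bound.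
  have hall : ∀ᵐ x ∂μ, ∀ n, ‖∑ k, TopologicalSpace.denseSeq (ι → ℂ) n k * (B (e k) : α → ℂ) x‖ ≤
      ‖B‖ * Real.sqrt (∑ k, ‖TopologicalSpace.denseSeq (ι → ℂ) n k‖ ^ 2) :=
    ae_all_iff.mpr fun n => hbound _
  filter_upwards [hall] with x hx
  have hclosed : IsClosed {c : ι → ℂ | ‖∑ k, c k * (B (e k) : α → ℂ) x‖ ≤
      ‖B‖ * Real.sqrt (∑ k, ‖c k‖ ^ 2)} :=
    isClosed_le (by fun_prop) (by fun_prop)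
  have hx' : ∀ c : ι → ℂ, ‖∑ k, c k * (B (e k) : α → ℂ) x‖ ≤
      ‖B‖ * Real.sqrt (∑ k, ‖c k‖ ^ 2) := fun c => by
    have hd := (TopologicalSpace.denseRange_denseSeq (ι → ℂ)).closure_eq
    have hsub := hclosed.closure_subset_iff.mpr (Set.range_subset_iff.mpr hx)
    rw [hd] at hsub
    exact hsub (Set.mem_univ c)
  -- The extremal coefficients, now allowed to depend on `x`: the bound becomes `σ ≤ ‖B‖ √σ`.
  have h := hx' fun k => conj ((B (e k) : α → ℂ) x)
  set σ := ∑ k, ‖(B (e k) : α → ℂ) x‖ ^ 2 with hσ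
  have hσ0 : 0 ≤ σ := Finset.sum_nonneg fun _ _ => by positivity
  have h6 : ∑ k, conj ((B (e k) : α → ℂ) x) * (B (e k) : α → ℂ) x = (σ : ℂ) := by
    rw [hσ]
    push_cast
    exact Finset.sum_congr rfl fun k _ => Complex.conj_mul' _
  simp only [RCLike.norm_conj] at h
  rw [h6, Complex.norm_real, Real.norm_of_nonneg hσ0, ← hσ] at h
  have hq := Real.sq_sqrt hσ0
  rcases (Real.sqrt_nonneg σ).eq_or_lt with h0 | h0
  · rw [← hq, ← h0, zero_pow two_ne_zero]
    positivity
  · have : Real.sqrt σ ≤ ‖B‖ := by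
      refine le_of_mul_le_mul_right ?_ h0
      rwa [← sq, hq]
    rw [← hq]
    gcongr

/-- The inclusion of `L∞` in `L₂`. -/
def linftyToL2 {α : Type*} [MeasurableSpace α] (μ : Measure α) [IsProbabilityMeasure μ] :
    Lp ℂ ∞ μ →ₗ[ℂ] Lp ℂ 2 μ where
  toFun f := MemLp.toLp f ((Lp.memLp f).mono_exponent le_top)
  map_add' f g := by
    rw [← MemLp.toLp_add]
    exact MemLp.toLp_congr _ _ (Lp.coeFn_add f g)
  map_smul' c f := by
    rw [RingHom.id_apply, ← MemLp.toLp_const_smul]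
    exact MemLp.toLp_congr _ _ (Lp.coeFn_smul c f)

theorem coeFn_linftyToL2 {α : Type*} [MeasurableSpace α] (μ : Measure α) [IsProbabilityMeasure μ]
    (f : Lp ℂ ∞ μ) : ⇑(linftyToL2 μ f) =ᵐ[μ] f :=
  MemLp.coeFn_toLp ((Lp.memLp f).mono_exponent le_top)

theorem sum_norm_sq_linftyToL2_le {α ι X : Type*} [MeasurableSpace α] {μ : Measure α}
    [IsProbabilityMeasure μ] [Fintype ι]
    [NormedAddCommGroup X] [NormedSpace ℂ X] (B : X →L[ℂ] Lp ℂ ∞ μ) (e : ι → X)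
    (he : ∀ c : ι → ℂ, ‖∑ k, c k • e k‖ ^ 2 = ∑ k, ‖c k‖ ^ 2) :
    ∑ k, ‖linftyToL2 μ (B (e k))‖ ^ 2 ≤ ‖B‖ ^ 2 := by
  have hnorm : ∀ f : Lp ℂ 2 μ, ‖f‖ ^ 2 = ∫ x, ‖f x‖ ^ 2 ∂μ := by
    intro f
    have h := L2.inner_def (𝕜 := ℂ) f f
    rw [inner_self_eq_norm_sq_to_K] at h
    simp only [inner_self_eq_norm_sq_to_K] at h
    have h2 : (∫ x, ((‖f x‖ : ℂ)) ^ 2 ∂μ) = ((∫ x, ‖f x‖ ^ 2 ∂μ : ℝ) : ℂ) := by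
      refine Eq.trans ?_ (integral_ofReal (𝕜 := ℂ) (f := fun x => ‖f x‖ ^ 2))
      simp
    refine Complex.ofReal_injective ?_
    rw [← h2]
    push_cast
    exact h
  have hint : ∀ k, Integrable (fun x => ‖linftyToL2 μ (B (e k)) x‖ ^ 2) μ := fun k =>
    (Lp.memLp (linftyToL2 μ (B (e k)))).integrable_norm_pow (by norm_num)
  have hae : ∀ᵐ x ∂μ, ∀ k, linftyToL2 μ (B (e k)) x = (B (e k) : α → ℂ) x :=
    ae_all_iff.mpr fun k => coeFn_linftyToL2 μ _
  calc ∑ k, ‖linftyToL2 μ (B (e k))‖ ^ 2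
      = ∫ x, ∑ k, ‖linftyToL2 μ (B (e k)) x‖ ^ 2 ∂μ := by
        rw [integral_finsetSum _ fun k _ => hint k]
        exact Finset.sum_congr rfl fun k _ => hnorm _
    _ ≤ ∫ _, ‖B‖ ^ 2 ∂μ := by
        refine integral_mono_ae (integrable_finsetSum _ fun k _ => hint k) (integrable_const _) ?_
        filter_upwards [ae_sum_norm_sq_le B e he, hae] with x hx hx2
        simpa only [hx2] using hx
    _ = _ := by simp

/-- The squared lengths of the projections of an orthonormal system on a finite-dimensional
subspace add up to at most the dimension. -/
theorem sum_norm_sq_starProjection_le {ι H : Type*} [NormedAddCommGroup H] [InnerProductSpace ℂ H]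
    (V : Submodule ℂ H) [FiniteDimensional ℂ V] {E : ι → H} (hE : Orthonormal ℂ E)
    (F : Finset ι) :
    ∑ k ∈ F, ‖V.starProjection (E k)‖ ^ 2 ≤ Module.finrank ℂ V := by
  set b := stdOrthonormalBasis ℂ V
  -- Expanding in an orthonormal basis of `V` and exchanging the sums leaves Bessel's inequality for
  -- each basis vector.
  have h1 : ∀ k, ‖V.starProjection (E k)‖ ^ 2 = ∑ i, ‖inner ℂ (E k) (b i : H)‖ ^ 2 := by
    intro k
    rw [Submodule.starProjection_apply, ← Submodule.coe_norm, ← b.sum_sq_norm_inner_right]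
    refine Finset.sum_congr rfl fun i _ => ?_
    rw [Submodule.coe_inner, ← Submodule.starProjection_apply,
      ← Submodule.inner_starProjection_left_eq_right,
      Submodule.starProjection_eq_self_iff.mpr (b i).2, norm_inner_symm]
  simp only [h1]
  rw [Finset.sum_comm]
  calc _ ≤ ∑ i : Fin (Module.finrank ℂ V), (1 : ℝ) := by
        refine Finset.sum_le_sum fun i _ => (hE.sum_inner_products_le _).trans ?_
        have : ‖(b i : H)‖ = 1 := b.orthonormal.1 i
        rw [this, one_pow]
    _ = _ := by simp

/-- A lower bound for the approximation numbers of the embedding in terms of the weights on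
any finite set of frequencies. -/
theorem le_norm_sub_sq (I A : SobolevSpace d s →L[ℂ] Lp ℂ ∞ (torusMeasure d))
    (hI : ∀ f, ⇑(I f) =ᵐ[torusMeasure d] ⇑(toL2 f)) {n : ℕ}
    (hA : (A : SobolevSpace d s →ₗ[ℂ] Lp ℂ ∞ (torusMeasure d)).rank < (n : Cardinal))
    (F : Finset (Fin d → ℤ)) {R : ℝ} (hR : 0 < R) (hF : ∀ k ∈ F, weightSq s k ≤ R) :
    R⁻¹ * (F.card - n) ≤ ‖I - A‖ ^ 2 := by
  set L : SobolevSpace d s →ₗ[ℂ] Lp ℂ 2 (torusMeasure d) :=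
    (linftyToL2 (torusMeasure d)).comp
      (A : SobolevSpace d s →ₗ[ℂ] Lp ℂ ∞ (torusMeasure d)) with hL
  have hLrank : L.rank < (n : Cardinal) := (LinearMap.rank_comp_le_right _ _).trans_lt hA
  set V := LinearMap.range L with hV
  have hfin : FiniteDimensional ℂ V :=
    Module.rank_lt_aleph0_iff.mp (hLrank.trans (Cardinal.natCast_lt_aleph0))
  have hdim : (Module.finrank ℂ V : ℝ) ≤ n := by
    have : (Module.finrank ℂ V : Cardinal) < n := by
      rw [Module.finrank_eq_rank]
      exact hLrank
    exact_mod_cast (Nat.cast_lt.mp this).le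
  have hIL : ∀ f, linftyToL2 (torusMeasure d) (I f) = toL2 f := fun f =>
    Lp.ext ((coeFn_linftyToL2 _ _).trans (hI f))
  have hmain := sum_norm_sq_linftyToL2_le (I - A) (fun k : F => basisVec s (k : Fin d → ℤ))
    (norm_sum_smul_basisVec_sq F)
  rw [Finset.sum_coe_sort F fun k =>
    ‖linftyToL2 (torusMeasure d) ((I - A) (basisVec s k))‖ ^ 2] at hmain
  have hterm : ∀ k ∈ F, R⁻¹ * (1 - ‖V.starProjection (torusExpL2 k)‖ ^ 2) ≤
      ‖linftyToL2 (torusMeasure d) ((I - A) (basisVec s k))‖ ^ 2 := by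
    intro k hk
    have hw := weightSq_pos s k
    have h1 : linftyToL2 (torusMeasure d) ((I - A) (basisVec s k)) =
        (((Real.sqrt (weightSq s k))⁻¹ : ℝ) : ℂ) • torusExpL2 k - L (basisVec s k) := by
      rw [_root_.sub_apply, map_sub, hIL, toL2_basisVec]
      rfl
    -- Projecting onto `Vᗮ` removes the contribution of `A`, whatever `A` is.
    have h2 : Vᗮ.starProjection (linftyToL2 (torusMeasure d) ((I - A) (basisVec s k))) =
        (((Real.sqrt (weightSq s k))⁻¹ : ℝ) : ℂ) • Vᗮ.starProjection (torusExpL2 k) := by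
      rw [h1, map_sub, map_smul, sub_eq_self]
      exact Submodule.starProjection_orthogonal_apply_eq_zero (LinearMap.mem_range_self L _)
    have h3 : ‖Vᗮ.starProjection (torusExpL2 k)‖ ^ 2 =
        1 - ‖V.starProjection (torusExpL2 k)‖ ^ 2 := by
      have h := Submodule.norm_sq_eq_add_norm_sq_starProjection (torusExpL2 k) V
      rw [(orthonormal_torusExpL2 d).1 k] at h
      linarith
    have h4 : ‖Vᗮ.starProjection (linftyToL2 (torusMeasure d) ((I - A) (basisVec s k)))‖ ≤
        ‖linftyToL2 (torusMeasure d) ((I - A) (basisVec s k))‖ :=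
      Submodule.norm_starProjection_apply_le _ _
    refine le_trans ?_ (pow_le_pow_left₀ (norm_nonneg _) h4 2)
    rw [h2, norm_smul, mul_pow, h3, Complex.norm_real, Real.norm_eq_abs, sq_abs, inv_pow,
      Real.sq_sqrt hw.le]
    refine mul_le_mul_of_nonneg_right (inv_anti₀ hw (hF k hk)) ?_
    rw [← h3]
    positivity
  refine le_trans ?_ ((Finset.sum_le_sum hterm).trans hmain)
  rw [← Finset.mul_sum, Finset.sum_sub_distrib]
  have h5 := sum_norm_sq_starProjection_le V (orthonormal_torusExpL2 d) F
  refine mul_le_mul_of_nonneg_left ?_ (inv_nonneg.mpr hR.le)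
  simp only [Finset.sum_const, nsmul_eq_mul, mul_one]
  linarith

/-! ### The explicit constants -/

theorem approxNumber_embedding_upper (hd : 1 ≤ d) (hs : (d : ℝ) / 2 < s) (n : ℕ)
    (hn : (9 : ℝ) ^ d * Real.exp ((d : ℝ) / 2) ≤ n) :
    approxNumber (embedding hd hs) (n + 1) ≤
      Real.sqrt (2 * d / (2 * s - d)) * (32 * Real.exp 1 / d) ^ (s / 2) *
        (n : ℝ) ^ (1 / 2 - s / d) := by
  have hd0 : (0 : ℝ) < d := by exact_mod_cast hd
  have hd1 : (1 : ℝ) ≤ d := by exact_mod_cast hd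
  have hs0 : 0 < s := (half_pos hd0).trans hs
  have hn0 : (0 : ℝ) < n := lt_of_lt_of_le (by positivity) hn
  have hsd : 0 < 2 * s - d := by linarith
  set y : ℝ := (n : ℝ) ^ (2 / (d : ℝ)) with hy
  have hy0 : 0 < y := by positivity
  have hy81 : 81 * Real.exp 1 ≤ y := by
    have h := Real.rpow_le_rpow (by positivity) hn (by positivity : 0 ≤ 2 / (d : ℝ))
    rw [Real.mul_rpow (by positivity) (by positivity), ← Real.rpow_natCast,
      ← Real.rpow_mul (by norm_num), ← Real.exp_mul, show (d : ℝ) * (2 / d) = 2 by field_simp,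
      show (d : ℝ) / 2 * (2 / d) = 1 by field_simp] at h
    norm_num at h
    exact h
  have hyn : y ^ ((d : ℝ) / 2) = n := by
    rw [hy, ← Real.rpow_mul hn0.le, show 2 / (d : ℝ) * (d / 2) = 1 by field_simp, Real.rpow_one]
  set K : ℝ := 16 * Real.exp 1 / d with hK
  have hK0 : 0 < K := by positivity
  -- Chosen so that the counting bound `(K ρ)^(d/2)` equals `n`. The requirement `ρ ≥ d/2` reads `y
  -- ≥ 8 e`.
  set ρ : ℝ := y / K with hρ
  have hρ0 : 0 < ρ := by positivity
  have hρd : (d : ℝ) / 2 ≤ ρ := by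
    rw [hρ, le_div_iff₀ hK0, hK]
    have : (d : ℝ) / 2 * (16 * Real.exp 1 / d) = 8 * Real.exp 1 := by field_simp; ring
    rw [this]
    linarith [Real.exp_pos 1]
  set Λ := (finite_bracketSq_le d ρ).toFinset with hΛ
  have hcard : Λ.card ≤ n := by
    have h := card_le_of_bracketSq_le hd hρd Λ fun k hk => by simpa [hΛ] using hk
    rw [← hK, ← Real.mul_rpow hK0.le hρ0.le, hρ, mul_div_cancel₀ _ hK0.ne', hyn] at h
    exact_mod_cast h
  refine (approxNumber_embedding_le hd hs Λ hcard fun F hF =>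
    sum_inv_weightSq_le hd hs hρd F fun k hk => by simpa [hΛ] using hF k hk).trans ?_
  rw [← hK]
  -- With `1 ≤ d` this gives `2 s ≤ 2 d 2^s`, which replaces the factor `s` at the price of turning
  -- `16` into `32`.
  have h2s : s ≤ 2 ^ s := by
    rcases le_total 1 s with h | h
    · have := one_add_mul_self_le_rpow_one_add (by norm_num : (-1 : ℝ) ≤ 1) h
      norm_num at this
      linarith
    · exact h.trans (Real.one_le_rpow (by norm_num) hs0.le)
  rw [show K ^ ((d : ℝ) / 2) = K ^ ((d : ℝ) / 2 - s) * K ^ s by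
      rw [← Real.rpow_add hK0]; ring_nf]
  rw [show s / (s - d / 2) * (K ^ ((d : ℝ) / 2 - s) * K ^ s) * ρ ^ ((d : ℝ) / 2 - s) =
      s / (s - d / 2) * K ^ s * (K * ρ) ^ ((d : ℝ) / 2 - s) by
    rw [Real.mul_rpow hK0.le hρ0.le]; ring]
  rw [show K * ρ = y from mul_div_cancel₀ _ hK0.ne']
  have hyr : y ^ ((d : ℝ) / 2 - s) = ((n : ℝ) ^ (1 / 2 - s / d)) ^ 2 := by
    rw [hy, ← Real.rpow_mul hn0.le, ← Real.rpow_natCast, ← Real.rpow_mul hn0.le]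
    congr 1
    push_cast
    field_simp
  rw [hyr]
  refine Real.sqrt_le_iff.mpr ⟨by positivity, ?_⟩
  rw [mul_pow, mul_pow, Real.sq_sqrt (by positivity)]
  have h32 : ((32 * Real.exp 1 / d) ^ (s / 2)) ^ 2 = 2 ^ s * K ^ s := by
    rw [← Real.rpow_natCast, ← Real.rpow_mul (by positivity), ← Real.mul_rpow (by norm_num) hK0.le,
      hK]
    push_cast
    congr 1 <;> ring
  rw [h32]
  refine mul_le_mul_of_nonneg_right ?_ (sq_nonneg _)
  rw [show s / (s - d / 2) = 2 * s / (2 * s - d) by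
    rw [div_eq_div_iff (by linarith) (by linarith)]; ring]
  rw [← mul_assoc]
  refine mul_le_mul_of_nonneg_right ?_ (by positivity)
  rw [div_mul_eq_mul_div]
  refine div_le_div_of_nonneg_right ?_ hsd.le
  nlinarith

theorem bracketSq_le_of_mem_piFinset {r : ℕ} {k : Fin d → ℤ}
    (hk : k ∈ Fintype.piFinset fun _ : Fin d => Finset.Icc (-(r : ℤ)) r) :
    bracketSq k ≤ 1 + d * (r : ℝ) ^ 2 := by
  rw [Fintype.mem_piFinset] at hk
  have h : ∑ j, |(k j : ℝ)| ^ 2 ≤ ∑ _j : Fin d, (r : ℝ) ^ 2 := by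
    refine Finset.sum_le_sum fun j _ => pow_le_pow_left₀ (abs_nonneg _) ?_ 2
    have := abs_le.mpr (Finset.mem_Icc.mp (hk j))
    exact_mod_cast this
  simp only [Finset.sum_const, Finset.card_univ, Fintype.card_fin, nsmul_eq_mul] at h
  unfold bracketSq
  linarith

theorem card_piFinset_Icc (d r : ℕ) :
    (Fintype.piFinset fun _ : Fin d => Finset.Icc (-(r : ℤ)) r).card = (2 * r + 1) ^ d := by
  rw [Fintype.card_piFinset]
  simp only [Int.card_Icc, Finset.prod_const, Finset.card_univ, Fintype.card_fin]
  congr 1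
  omega

/-- For `d ≥ 2` the base exceeds `9`, which is ample; the case `d = 1` is tight, since `3 e / 0.282`
is about `28.9` and the left side about `28.4`. -/
theorem sixteen_thirds_sq_le_pow (hd : 1 ≤ d) :
    (16 / 3 : ℝ) ^ 2 ≤ (Real.exp 1 * (d + 2) / (0.282 * d)) ^ d := by
  have hd0 : (0 : ℝ) < d := by exact_mod_cast hd
  have he := Real.exp_one_gt_d9
  have h9 : (9 : ℝ) ≤ Real.exp 1 * (d + 2) / (0.282 * d) := by
    rw [le_div_iff₀ (by positivity)]
    nlinarith
  rcases hd.eq_or_lt with rfl | h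
  · norm_num at he ⊢
    linarith
  · calc (16 / 3 : ℝ) ^ 2 ≤ 9 ^ 2 := by norm_num
      _ ≤ (9 : ℝ) ^ d := pow_le_pow_right₀ (by norm_num) h
      _ ≤ _ := pow_le_pow_left₀ (by norm_num) h9 d

theorem approxNumber_lower (hd : 1 ≤ d) (hs : (d : ℝ) / 2 < s)
    (I : SobolevSpace d s →L[ℂ] Lp ℂ ∞ (torusMeasure d))
    (hI : ∀ f, ⇑(I f) =ᵐ[torusMeasure d] ⇑(SobolevSpace.toL2 f)) (n : ℕ)
    (hn : (11 : ℝ) ^ d * Real.exp ((d : ℝ) / 2) ≤ n) :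
    Real.sqrt (4 * d / (4 * s - d)) * (1 / (Real.exp 1 * (d + 2))) ^ (s / 2) *
        (n : ℝ) ^ (1 / 2 - s / d) ≤ approxNumber I n := by
  have hd0 : (0 : ℝ) < d := by exact_mod_cast hd
  have hd1 : (1 : ℝ) ≤ d := by exact_mod_cast hd
  have hs0 : 0 < s := (half_pos hd0).trans hs
  have hn0 : (0 : ℝ) < n := lt_of_lt_of_le (by positivity) hn
  have hsd : 0 < 4 * s - d := by linarith
  -- The side length making the cube contain at least `4 n` frequencies, so that at least `3 n`
  -- survive the loss of `n` dimensions.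
  set x : ℝ := (4 * n : ℝ) ^ (1 / (d : ℝ)) with hx
  have hx0 : 0 < x := by positivity
  have hxd : x ^ d = 4 * n := by
    rw [hx, ← Real.rpow_natCast, ← Real.rpow_mul (by positivity), one_div_mul_cancel hd0.ne',
      Real.rpow_one]
  -- This comes from `11 e^(1/2) > 18`.
  have hx18 : 18 ≤ x := by
    have h1 : (18 : ℝ) ^ d ≤ x ^ d := by
      rw [hxd]
      have h2 : Real.exp ((d : ℝ) / 2) = Real.exp (1 / 2) ^ d := by
        rw [← Real.exp_nat_mul]; ring_nf
      have h3 : (18 / 11 : ℝ) ≤ Real.exp (1 / 2) := by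
        refine le_of_pow_le_pow_left₀ two_ne_zero (Real.exp_pos _).le ?_
        rw [← Real.exp_nat_mul, show ((2 : ℕ) : ℝ) * (1 / 2) = 1 by norm_num]
        linarith [Real.exp_one_gt_d9]
      have h4 : (18 : ℝ) ^ d ≤ (11 : ℝ) ^ d * Real.exp ((d : ℝ) / 2) := by
        rw [h2, ← mul_pow]
        exact pow_le_pow_left₀ (by norm_num) (by linarith) d
      linarith
    exact le_of_pow_le_pow_left₀ (by omega) hx0.le h1
  set r : ℕ := ⌈(x - 1) / 2⌉₊ with hr
  have hr1 : x ≤ 2 * r + 1 := by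
    have := Nat.le_ceil ((x - 1) / 2)
    rw [← hr] at this
    linarith
  have hr2 : (r : ℝ) ≤ (x + 1) / 2 := by
    have := Nat.ceil_lt_add_one (a := (x - 1) / 2) (by linarith)
    rw [← hr] at this
    linarith
  set C : ℝ := 0.282 * d with hC
  have hC0 : 0 < C := by positivity
  -- The constant `0.282` slightly exceeds `1/4`, to absorb the rounding of `r` and the summand `1`
  -- once `x ≥ 18`.
  have hCx : 1 + d * (r : ℝ) ^ 2 ≤ C * x ^ 2 := by
    have h1 : (r : ℝ) ^ 2 ≤ ((x + 1) / 2) ^ 2 := pow_le_pow_left₀ (by positivity) hr2 2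
    have h2 : 1 + ((x + 1) / 2) ^ 2 ≤ 0.282 * x ^ 2 := by nlinarith
    rw [hC]
    nlinarith
  set F := Fintype.piFinset fun _ : Fin d => Finset.Icc (-(r : ℤ)) r with hF
  have hcard : (4 * n : ℝ) ≤ F.card := by
    rw [hF, card_piFinset_Icc, ← hxd]
    push_cast
    exact pow_le_pow_left₀ hx0.le hr1 d
  have hw : ∀ k ∈ F, weightSq s k ≤ (C * x ^ 2) ^ s := fun k hk =>
    Real.rpow_le_rpow (zero_le_one.trans (one_le_bracketSq k))
      ((bracketSq_le_of_mem_piFinset hk).trans hCx) hs0.le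
  have hR0 : 0 < (C * x ^ 2) ^ s := by positivity
  refine le_approxNumber I (by exact_mod_cast hn0) fun A hA => ?_
  have hmain := le_norm_sub_sq I A hI hA F hR0 hw
  refine le_of_sq_le_sq ?_ (norm_nonneg _)
  refine le_trans ?_ hmain
  rw [mul_pow, mul_pow, Real.sq_sqrt (by positivity)]
  set D : ℝ := Real.exp 1 * (d + 2) with hD
  have hD0 : 0 < D := by positivity
  have hp : ((1 / D) ^ (s / 2)) ^ 2 = (D ^ s)⁻¹ := by
    rw [← Real.rpow_natCast, ← Real.rpow_mul (by positivity), one_div, Real.inv_rpow hD0.le]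
    push_cast
    ring_nf
  have hnn : ((n : ℝ) ^ (1 / 2 - s / d)) ^ 2 = n * ((n : ℝ) ^ (2 * s / d))⁻¹ := by
    rw [← Real.rpow_natCast, ← Real.rpow_mul hn0.le, ← Real.rpow_neg hn0.le]
    nth_rewrite 2 [← Real.rpow_one (n : ℝ)]
    rw [← Real.rpow_add hn0]
    congr 1
    push_cast
    ring
  have hxs : (x ^ 2) ^ s = 16 ^ (s / d) * (n : ℝ) ^ (2 * s / d) := by
    rw [hx, ← Real.rpow_natCast, ← Real.rpow_mul (by positivity), ← Real.rpow_mul (by positivity),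
      Real.mul_rpow (by norm_num) hn0.le, show (16 : ℝ) = 4 ^ (2 : ℝ) by norm_num,
      ← Real.rpow_mul (by norm_num)]
    push_cast
    congr 2 <;> ring
  rw [hp, hnn, Real.mul_rpow hC0.le (by positivity), hxs]
  set N : ℝ := (n : ℝ) ^ (2 * s / d) with hN
  have hN0 : 0 < N := by positivity
  -- Here `(16/3)^2 = 16 (4/3)^2`: raised to the power `s/d > 1/2`, the `16` cancels the factor from
  -- `(4 n)^(2 s / d)` and at least `4/3` remains. Together with `4 d / (4 s - d) ≤ 4` this leaves
  -- exactly the factor `3` of `3 n`.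
  have h16 : 4 / 3 * (16 : ℝ) ^ (s / d) * C ^ s ≤ D ^ s := by
    have h1 := sixteen_thirds_sq_le_pow hd
    rw [← hD, ← hC] at h1
    have h2 : (4 / 3 : ℝ) ^ 2 ≤ (D / C) ^ d / 16 := by linarith
    have h3 : (4 / 3 : ℝ) ≤ ((D / C) ^ d / 16) ^ (s / d) := by
      have h4 : (4 / 3 : ℝ) ^ (1 : ℝ) ≤ (4 / 3 : ℝ) ^ (2 * (s / d)) := by
        refine Real.rpow_le_rpow_of_exponent_le (by norm_num) ?_
        rw [mul_div_assoc', le_div_iff₀ hd0]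
        linarith
      rw [Real.rpow_one, Real.rpow_mul (by norm_num)] at h4
      refine h4.trans (Real.rpow_le_rpow (by positivity) ?_ (by positivity))
      exact_mod_cast h2
    rw [Real.div_rpow (by positivity) (by norm_num), ← Real.rpow_natCast (D / C) d,
      ← Real.rpow_mul (by positivity), mul_div_cancel₀ s hd0.ne',
      Real.div_rpow hD0.le hC0.le, le_div_iff₀ (by positivity), le_div_iff₀ (by positivity)] at h3
    exact h3
  have h4d : 4 * d / (4 * s - d) ≤ 4 := by
    rw [div_le_iff₀ hsd]
    linarith
  calc 4 * d / (4 * s - d) * (D ^ s)⁻¹ * (n * N⁻¹)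
      ≤ 4 * (4 / 3 * (16 : ℝ) ^ (s / d) * C ^ s)⁻¹ * (n * N⁻¹) := by
        gcongr
    _ = (C ^ s * (16 ^ (s / d) * N))⁻¹ * (3 * n) := by
        field_simp
    _ ≤ _ := by
        refine mul_le_mul_of_nonneg_left ?_ (by positivity)
        linarith

end PeriodicSobolev

end

theorem corollary1 (d : ℕ) (hd : 1 ≤ d) (s : ℝ) (hs : (d : ℝ) / 2 < s) :
    ∃ I : PeriodicSobolev.SobolevSpace d s →L[ℂ] Lp ℂ ∞ (PeriodicSobolev.torusMeasure d),
      (∀ f : PeriodicSobolev.SobolevSpace d s,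
        ⇑(I f) =ᵐ[PeriodicSobolev.torusMeasure d] ⇑(PeriodicSobolev.SobolevSpace.toL2 f)) ∧
      (∀ n : ℕ, (9 : ℝ) ^ d * Real.exp ((d : ℝ) / 2) ≤ (n : ℝ) →
        PeriodicSobolev.approxNumber I (n + 1) ≤
          Real.sqrt (2 * d / (2 * s - d)) * (32 * Real.exp 1 / d) ^ (s / 2) *
            (n : ℝ) ^ (1 / 2 - s / d)) ∧
      (∀ n : ℕ, (11 : ℝ) ^ d * Real.exp ((d : ℝ) / 2) ≤ (n : ℝ) →
        Real.sqrt (4 * d / (4 * s - d)) * (1 / (Real.exp 1 * (d + 2))) ^ (s / 2) *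
            (n : ℝ) ^ (1 / 2 - s / d) ≤
          PeriodicSobolev.approxNumber I n) := by
  exact ⟨PeriodicSobolev.embedding hd hs, PeriodicSobolev.embedding_ae_eq hd hs,
    PeriodicSobolev.approxNumber_embedding_upper hd hs,
    PeriodicSobolev.approxNumber_lower hd hs _ (PeriodicSobolev.embedding_ae_eq hd hs)⟩
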